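/- **Setting.** A system has $n$ replicas with identifiers $0,\dots,n-1$, at most $f$ of which are faulty, where $n>3f$. Faulty replicas behave arbitrarily and may collude, but cannot forge signatures of non-faulty replicas. Communication is asynchronous: messages can be lost, duplicated or arbitrarily delayed. The digest function is collision-free. The replicas run a single chained PVP instance, in views $0,1,2,\dots$; the primary of view $v$ is the replica with identifier $v \bmod n$. **Proposals.** A proposal is the genesis proposal (with a view below all others) or a message $m=\mathrm{Propose}(v,\tau,\cdot)$ signed by the primary of view $v$, with a client request $\tau$ and a claim (view and digest) for a *preceding proposal* $P$, with or without a certificate for $P$; we say that $m$ *extends* $P$. A certificate for $P$ is a set of signed messages $\mathrm{Sync}(\mathrm{view}(P),\mathrm{claim}(P),\cdot)$ from $n-f$ replicas. "Precedes" is the transitive closure of "is the preceding proposal of". Two proposals are *conflicting* if neither is on the other's chain to the genesis proposal, i.e. they are distinct and neither precedes the other. **Rules for non-faulty replicas.** A replica only moves to higher views. * A replica *conditionally prepares* $P$ after receiving $\mathrm{Sync}(\mathrm{view}(P),\mathrm{claim}(P),\cdot)$ from $n-f$ replicas, or a proposal that carries a valid certificate for $P$, or $\mathrm{Sync}(w,\cdot,CP)$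 with $w\ge \mathrm{view}(P)$ and $\mathrm{claim}(P)\in CP$ from $f+1$ replicas ($w$ may depend on the sender). The genesis proposal is conditionally prepared from the start. * A replica *conditionally commits* $P$ if it conditionally prepares a proposal of a higher view that extends $P$ (the genesis proposal is conditionally committed from the start). Its *locked* proposal $P_{lock}$ is the highest proposal that it conditionally commits. * The component $CP$ of its Sync messages consists of the claims for all proposals $P$ it has conditionally prepared with $\mathrm{view}(P)\ge\mathrm{view}(P_{lock})$. * A replica in view $v$ *records* the first proposal of view $v$ that it receives from the primary with a valid request and whose preceding proposal it has conditionally prepared or is certified by a valid certificate in the proposal. * A replica in view $v$ *accepts* a proposal $m$ of view $v$, by broadcasting $\mathrm{Sync}(v,\mathrm{claim}(m),CP)$, only if it recorded $m$ or received $\mathrm{Sync}(v,\mathrm{claim}(m),\cdot)$ from $f+1$ replicas, it has conditionally prepared the preceding proposal $P$ of $m$, and either $P_{lock}=P$ or $P_{lock}$ precedes $P$, or $\mathrm{view}(P)>\mathrm{view}(P_{lock})$. It accepts at most one proposal per view. It may also broadcast $\mathrm{Sync}(u,\varnothing,CP)$ to report a failure in, or catch up on, a view $u$. * As primary of its current view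 $v$, a replica proposes at most once in view $v$, with a valid request that it has not yet proposed. Its proposal extends the genesis proposal, or a proposal for which it includes a valid certificate, or a proposal whose claim is in the $CP$ of Sync messages of views lower than $v$ received from $n-f$ replicas. **Commit.** A replica *commits* a proposal $P$ of view $v$ if it conditionally prepares a proposal $P'$ of view $v+1$ that extends $P$ and a proposal $P''$ of view $v+2$ that extends $P'$. (In particular it commits $P$ if it conditionally prepares three such proposals $P,P',P''$ in consecutive views.) **Theorem.** In no execution are there two conflicting proposals $P_1$ and $P_2$ and non-faulty replicas $R_1$ and $R_2$ (possibly equal) such that $R_1$ commits $P_1$ and $R_2$ commits $P_2$. -/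

import Mathlib

/-!
# A single chained PVP instance

There are `n` replicas, with identifiers `0, …, n - 1` (the type `Fin n`).  `D` is the type of message
digests and `Req` the type of (signed) client requests.

The protocol is a transition system.  Communication is asynchronous: a message that was sent can be
delivered to any replica, at any later moment, any number of times, or never.  Faulty replicas can send
everything that does not carry the signature of a non-faulty replica, at any moment and to anyone.
-/

namespace PVP

/-- A claim for a proposal: its view and its digest.  The genesis proposal has view `⊥`, which lies below
the views `0, 1, 2, …` of the instance. -/
structure Claim (D : Type*) where
  view : WithBot ℕ
  digest : D

/-- The signed message `Sync(view, claim, CP)`; `claim = none` is the claim of a failure in that view. -/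
structure SyncMsg (n : ℕ) (D : Type*) where
  sender : Fin n
  view : ℕ
  claim : Option (Claim D)
  cp : Finset (Claim D)

/-- The message `Propose(view, request, ·)`, signed by the primary of `view`.  Its last component refers to
the preceding proposal through a claim, together with a certificate (a set of signed `Sync` messages)
when `cert` is not `none`. -/
structure ProposeMsg (n : ℕ) (D Req : Type*) where
  view : ℕ
  request : Req
  parent : Claim D
  cert : Option (Finset (SyncMsg n D))

/-- A proposal is either the genesis proposal or a `Propose` message. -/
inductive Proposal (n : ℕ) (D Req : Type*) where
  | genesis : Proposal n D Req
  | propose (m : ProposeMsg n D Req) : Proposal n D Req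

/-- The messages that replicas exchange.  `Ask` messages, requests for resending and the answers to them
are not listed: they only cause messages that were already sent to be delivered (again), which is
possible at any moment here. -/
inductive Msg (n : ℕ) (D Req : Type*) where
  | propose (m : ProposeMsg n D Req) : Msg n D Req
  | sync (σ : SyncMsg n D) : Msg n D Req

/-- What is fixed during an execution: the number `f` that determines the sizes of the quorums, the set of
faulty replicas, which client requests are valid, and the hash function. -/
structure Config (n : ℕ) (D Req : Type*) where
  f : ℕ
  faulty : Finset (Fin n)
  validRequest : Req → Prop
  digest : Proposal n D Req → D

variable {n : ℕ} {D Req : Type*}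

/-- Replica `r` is the primary of view `v`. -/
def IsPrimary (r : Fin n) (v : ℕ) : Prop := (r : ℕ) = v % n

/-- The replica `r` is the one that signs the message. -/
def Msg.SignedBy : Msg n D Req → Fin n → Prop
  | .propose m, r => IsPrimary r m.view
  | .sync σ, r => σ.sender = r

/-- The view of a proposal. -/
def Proposal.view : Proposal n D Req → WithBot ℕ
  | .genesis => ⊥
  | .propose m => (m.view : WithBot ℕ)

/-- The claim that represents the proposal `P`. -/
def Config.claimOf (C : Config n D Req) (P : Proposal n D Req) : Claim D :=
  ⟨P.view, C.digest P⟩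

/-! ### Chains of proposals -/

/-- `P` is the preceding proposal of the second argument. -/
def Config.IsParent (C : Config n D Req) (P : Proposal n D Req) : Proposal n D Req → Prop
  | .genesis => False
  | .propose m => m.parent = C.claimOf P

/-- `P` precedes `Q`. -/
def Config.Precedes (C : Config n D Req) (P Q : Proposal n D Req) : Prop :=
  Relation.TransGen C.IsParent P Q

/-- `P` and `Q` are conflicting: neither lies on the chain from the other one to the genesis proposal. -/
def Config.Conflicting (C : Config n D Req) (P Q : Proposal n D Req) : Prop :=
  P ≠ Q ∧ ¬ C.Precedes P Q ∧ ¬ C.Precedes Q P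

/-! ### Global states -/

/-- A global state.  `sent` holds all messages signed and sent so far.  The other components are local to the
replicas: the messages received, the current view, the recorded proposals, and the conditionally
prepared proposals.  (For faulty replicas the last three are meaningless.) -/
structure State (n : ℕ) (D Req : Type*) where
  sent : Set (Msg n D Req)
  received : Fin n → Set (Msg n D Req)
  view : Fin n → ℕ
  recorded : Fin n → Set (ProposeMsg n D Req)
  prepared : Fin n → Set (Proposal n D Req)

/-- At the start no message was sent, every replica is in view `0`, and only the genesis proposal counts as
conditionally prepared. -/
def State.start : State n D Req where
  sent := ∅
  received := fun _ => ∅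
  view := fun _ => 0
  recorded := fun _ => ∅
  prepared := fun _ => {Proposal.genesis}

/-- The state after `msg` was sent. -/
def State.send (s : State n D Req) (msg : Msg n D Req) : State n D Req :=
  { s with sent := insert msg s.sent }

/-- The state after `msg` was delivered to `r`. -/
def State.deliver (s : State n D Req) (r : Fin n) (msg : Msg n D Req) : State n D Req :=
  { s with received := Function.update s.received r (insert msg (s.received r)) }

/-- The state after `r` moved to view `w`. -/
def State.enter (s : State n D Req) (r : Fin n) (w : ℕ) : State n D Req :=
  { s with view := Function.update s.view r w }

/-- The state after `r` recorded `m`. -/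
def State.record (s : State n D Req) (r : Fin n) (m : ProposeMsg n D Req) : State n D Req :=
  { s with recorded := Function.update s.recorded r (insert m (s.recorded r)) }

/-- The state after `r` conditionally prepared `P`. -/
def State.prepare (s : State n D Req) (r : Fin n) (P : Proposal n D Req) : State n D Req :=
  { s with prepared := Function.update s.prepared r (insert P (s.prepared r)) }

/-! ### Conditional commits, locks and commits -/

/-- Replica `r` conditionally commits `P`: it conditionally prepared, in a higher view, a proposal that extends
`P`.  The genesis proposal counts as conditionally committed from the start. -/
def State.CondCommits (C : Config n D Req) (s : State n D Req) (r : Fin n) (P : Proposal n D Req) : Prop :=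
  P = Proposal.genesis ∨ ∃ P' ∈ s.prepared r, C.IsParent P P' ∧ P.view < P'.view

/-- Replica `r` locks `L`: among the proposals that it conditionally commits, `L` is the highest. -/
def State.Locks (C : Config n D Req) (s : State n D Req) (r : Fin n) (L : Proposal n D Req) : Prop :=
  s.CondCommits C r L ∧ ∀ P, s.CondCommits C r P → P.view ≤ L.view

/-- Replica `r` commits `P`, a proposal of some view `v`: it conditionally prepared a proposal `P'` of view
`v + 1` that extends `P`, and a proposal `P''` of view `v + 2` that extends `P'`. -/
def State.Commits (C : Config n D Req) (s : State n D Req) (r : Fin n) (P : Proposal n D Req) : Prop :=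
  ∃ (v : ℕ) (P' P'' : Proposal n D Req),
    P.view = (v : WithBot ℕ) ∧
    P' ∈ s.prepared r ∧ C.IsParent P P' ∧ P'.view = ((v + 1 : ℕ) : WithBot ℕ) ∧
    P'' ∈ s.prepared r ∧ C.IsParent P' P'' ∧ P''.view = ((v + 2 : ℕ) : WithBot ℕ)

/-! ### The rules for non-faulty replicas -/

/-- `σ` is a `Sync` message, for the view of the claim `c`, that carries the claim `c`. -/
def SyncMsg.Supports (σ : SyncMsg n D) (c : Claim D) : Prop :=
  (σ.view : WithBot ℕ) = c.view ∧ σ.claim = some c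

/-- Replica `r` received, from at least `k` distinct replicas, a `Sync` message with the property `p`. -/
def State.ReceivedSyncs (s : State n D Req) (r : Fin n) (k : ℕ) (p : SyncMsg n D → Prop) : Prop :=
  ∃ Q : Finset (Fin n), k ≤ Q.card ∧
    ∀ q ∈ Q, ∃ σ : SyncMsg n D, Msg.sync σ ∈ s.received r ∧ σ.sender = q ∧ p σ

/-- `S` is a valid certificate for the proposal with claim `c`: all signatures in `S` are valid (the messages
really were sent by their senders), and `n - f` replicas support `c` in `S`. -/
def State.ValidCert (C : Config n D Req) (s : State n D Req) (S : Finset (SyncMsg n D)) (c : Claim D) : Prop :=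
  (∀ σ ∈ S, Msg.sync σ ∈ s.sent) ∧
  ∃ Q : Finset (Fin n), n - C.f ≤ Q.card ∧ ∀ q ∈ Q, ∃ σ ∈ S, σ.sender = q ∧ σ.Supports c

/-- `m` carries a valid certificate for its preceding proposal. -/
def State.Certified (C : Config n D Req) (s : State n D Req) (m : ProposeMsg n D Req) : Prop :=
  ∃ S, m.cert = some S ∧ s.ValidCert C S m.parent

/-- Replica `r`, as primary, may let `m` extend its preceding proposal: that is the genesis proposal, or `m` has
a valid certificate for it, or `n - f` replicas claimed in lower views to have conditionally prepared it.
(The primary takes the highest such proposal; here it may take any.) -/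
def State.Extendable (C : Config n D Req) (s : State n D Req) (r : Fin n) (m : ProposeMsg n D Req) : Prop :=
  (m.parent = C.claimOf Proposal.genesis ∧ m.cert = none) ∨
  s.Certified C m ∨
  (m.cert = none ∧ s.ReceivedSyncs r (n - C.f) (fun σ => σ.view < m.view ∧ m.parent ∈ σ.cp))

/-- Replica `r` finds `m` acceptable: it conditionally prepared the preceding proposal `P` of `m` (validity rule),
and its locked proposal `L` is `P` or precedes `P` (safety rule) or has a lower view than `P` (liveness
rule). -/
def State.Acceptable (C : Config n D Req) (s : State n D Req) (r : Fin n) (m : ProposeMsg n D Req) : Prop :=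
  ∃ P ∈ s.prepared r, m.parent = C.claimOf P ∧
    ∃ L, s.Locks C r L ∧ ((L = P ∨ C.Precedes L P) ∨ L.view < P.view)

/-- `cp` is the set `CP` of replica `r`: the claims for all proposals that `r` conditionally prepared and whose view
is at least that of the locked proposal. -/
def State.IsCP (C : Config n D Req) (s : State n D Req) (r : Fin n) (cp : Finset (Claim D)) : Prop :=
  ∃ L, s.Locks C r L ∧
    ∀ c, c ∈ cp ↔ ∃ P ∈ s.prepared r, L.view ≤ P.view ∧ c = C.claimOf P

/-- One step of an execution. -/
inductive Step (C : Config n D Req) : State n D Req → State n D Req → Prop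
  /-- The network delivers a message that was sent. -/
  | deliver (s : State n D Req) (r : Fin n) (msg : Msg n D Req)
      (hsent : msg ∈ s.sent) :
      Step C s (s.deliver r msg)
  /-- Faulty replicas send an arbitrary message with the signature of a faulty replica. -/
  | byzantine (s : State n D Req) (b : Fin n) (msg : Msg n D Req)
      (hb : b ∈ C.faulty) (hsig : msg.SignedBy b) :
      Step C s (s.send msg)
  /-- A non-faulty replica moves to a higher view.  When it does so is governed by timers and by rapid view
  synchronization; here it can happen at any moment. -/
  | enter (s : State n D Req) (r : Fin n) (w : ℕ)
      (hr : r ∉ C.faulty) (hw : s.view r < w) :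
      Step C s (s.enter r w)
  /-- The non-faulty primary of the current view proposes a valid request that it has not yet proposed. -/
  | propose (s : State n D Req) (r : Fin n) (m : ProposeMsg n D Req)
      (hr : r ∉ C.faulty) (hv : m.view = s.view r) (hp : IsPrimary r m.view)
      (hreq : C.validRequest m.request)
      (hnew : ∀ m', Msg.propose m' ∈ s.sent → IsPrimary r m'.view →
        m'.view ≠ m.view ∧ m'.request ≠ m.request)
      (hext : s.Extendable C r m) :
      Step C s (s.send (Msg.propose m))
  /-- A non-faulty replica records the first well-formed proposal of its current view. -/
  | record (s : State n D Req) (r : Fin n) (m : ProposeMsg n D Req)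
      (hr : r ∉ C.faulty) (hrec : Msg.propose m ∈ s.received r) (hv : m.view = s.view r)
      (hreq : C.validRequest m.request)
      (hagree : (∃ P ∈ s.prepared r, m.parent = C.claimOf P) ∨ s.Certified C m)
      (hfirst : ∀ m' ∈ s.recorded r, m'.view ≠ m.view) :
      Step C s (s.record r m)
  /-- A non-faulty replica accepts an acceptable proposal of its current view, which it recorded or for which it
  received `Sync` messages from `f + 1` replicas: it broadcasts a `Sync` message with a claim for it.  It
  does so at most once per view. -/
  | accept (s : State n D Req) (r : Fin n) (m : ProposeMsg n D Req) (cp : Finset (Claim D))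
      (hr : r ∉ C.faulty) (hv : m.view = s.view r)
      (hknown : m ∈ s.recorded r ∨
        s.ReceivedSyncs r (C.f + 1) (fun σ => σ.Supports (C.claimOf (Proposal.propose m))))
      (hacc : s.Acceptable C r m)
      (honce : ∀ σ : SyncMsg n D, Msg.sync σ ∈ s.sent → σ.sender = r → σ.view = m.view → σ.claim = none)
      (hcp : s.IsCP C r cp) :
      Step C s (s.send (Msg.sync ⟨r, m.view, some (C.claimOf (Proposal.propose m)), cp⟩))
  /-- A non-faulty replica broadcasts a `Sync` message with the empty claim for some view. -/
  | failure (s : State n D Req) (r : Fin n) (u : ℕ) (cp : Finset (Claim D))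
      (hr : r ∉ C.faulty) (hcp : s.IsCP C r cp) :
      Step C s (s.send (Msg.sync ⟨r, u, none, cp⟩))
  /-- A non-faulty replica conditionally prepares a proposal after receiving `Sync` messages with a claim for it
  from `n - f` replicas. -/
  | prepareSync (s : State n D Req) (r : Fin n) (P : Proposal n D Req)
      (hr : r ∉ C.faulty)
      (hq : s.ReceivedSyncs r (n - C.f) (fun σ => σ.Supports (C.claimOf P))) :
      Step C s (s.prepare r P)
  /-- A non-faulty replica conditionally prepares the preceding proposal of a received proposal that carries a
  valid certificate for it. -/
  | prepareCert (s : State n D Req) (r : Fin n) (m : ProposeMsg n D Req) (P : Proposal n D Req)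
      (hr : r ∉ C.faulty) (hrec : Msg.propose m ∈ s.received r)
      (hcert : s.Certified C m) (hP : m.parent = C.claimOf P) :
      Step C s (s.prepare r P)
  /-- A non-faulty replica conditionally prepares a proposal when `f + 1` replicas claim, in `Sync` messages of its
  view or a higher one, to have conditionally prepared it. -/
  | prepareClaims (s : State n D Req) (r : Fin n) (P : Proposal n D Req)
      (hr : r ∉ C.faulty)
      (hq : s.ReceivedSyncs r (C.f + 1) (fun σ => P.view ≤ (σ.view : WithBot ℕ) ∧ C.claimOf P ∈ σ.cp)) :
      Step C s (s.prepare r P)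

/-- The state `s` occurs in an execution of the protocol. -/
def Reachable (C : Config n D Req) (s : State n D Req) : Prop :=
  Relation.ReflTransGen (Step C) State.start s

end PVP

/-!
# Safety of a chained PVP instance

Call a `Sync` message with a claim a *vote*.  A non-faulty replica votes at most once per view, in
increasing views, and any two sets of `n - f` replicas share a non-faulty one.  Every proposal that a
non-faulty replica conditionally prepares is the genesis proposal or has votes from `n - f` replicas (it is
*certified*): among `f + 1` replicas claiming to have prepared it, one is non-faulty.  Hence each view has at
most one certified proposal (`Invariant.certified_unique`).

The parent of a certified proposal is certified, because the voters prepared it, and it has a lower view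
(`Invariant.certified_parent`): the parent had its quorum before the first non-faulty vote for the child, so
some non-faulty replica voted for the parent first and for the child afterwards.  The digest function alone
would not exclude cyclic chains.

Let `P`, `P'`, `P''` be certified, each extending the one before, in the views `v`, `v + 1`, `v + 2`.  Then
every certified `Q` with a view of at least `v` is `P` or a descendant of `P`
(`Invariant.certified_eq_or_precedes`), by strong induction on the view.  The views up to `v + 2` are settled
by uniqueness.  In a higher view, some non-faulty replica voted for `P''` and later for `Q`.  At the first
vote it had prepared `P'`, so its lock had a view of at least `v` ever after.  At the second vote, both the
safety and the liveness rule then force the parent of `Q` to have a view of at least `v`, and the induction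
hypothesis applies to that parent.
-/

namespace PVP

variable {n : ℕ} {D Req : Type*}

/-! ### Votes and certified proposals -/

/-- Replica `q` sent a `Sync` message that supports the claim `c`. -/
def State.Voted (s : State n D Req) (q : Fin n) (c : Claim D) : Prop :=
  ∃ σ : SyncMsg n D, Msg.sync σ ∈ s.sent ∧ σ.sender = q ∧ σ.Supports c

/-- `P` is the genesis proposal, or `n - f` replicas voted for it. -/
def State.IsCertified (C : Config n D Req) (s : State n D Req) (P : Proposal n D Req) : Prop :=
  P = Proposal.genesis ∨
    ∃ Q : Finset (Fin n), n - C.f ≤ Q.card ∧ ∀ q ∈ Q, s.Voted q (C.claimOf P)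

theorem Config.claimOf_injective {C : Config n D Req} (hC : Function.Injective C.digest) :
    Function.Injective C.claimOf := fun _ _ h => hC (congrArg Claim.digest h)

theorem State.Voted.mono {s t : State n D Req} (h : s.sent ⊆ t.sent) {q : Fin n} {c : Claim D}
    (hv : s.Voted q c) : t.Voted q c := by
  obtain ⟨σ, h1, h2⟩ := hv
  exact ⟨σ, h h1, h2⟩

theorem State.IsCertified.mono {C : Config n D Req} {s t : State n D Req} (h : s.sent ⊆ t.sent)
    {P : Proposal n D Req} (hP : s.IsCertified C P) : t.IsCertified C P := by
  obtain hP | ⟨Q, hQ, hv⟩ := hP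
  · exact Or.inl hP
  · exact Or.inr ⟨Q, hQ, fun q hq => (hv q hq).mono h⟩

theorem State.voted_send {s : State n D Req} {msg : Msg n D Req} {q : Fin n} {c : Claim D} :
    (s.send msg).Voted q c ↔
      s.Voted q c ∨ ∃ σ : SyncMsg n D, msg = Msg.sync σ ∧ σ.sender = q ∧ σ.Supports c := by
  constructor
  · rintro ⟨σ, h1, h2⟩
    rcases h1 with h1 | h1
    · exact Or.inr ⟨σ, h1.symm, h2⟩
    · exact Or.inl ⟨σ, h1, h2⟩
  · rintro (⟨σ, h1, h2⟩ | ⟨σ, rfl, h2⟩)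
    · exact ⟨σ, Or.inr h1, h2⟩
    · exact ⟨σ, Or.inl rfl, h2⟩

theorem exists_nonfaulty_mem {C : Config n D Req} (hfaulty : C.faulty.card ≤ C.f)
    {Q : Finset (Fin n)} (hQ : C.f < Q.card) : ∃ q ∈ Q, q ∉ C.faulty :=
  Finset.exists_mem_notMem_of_card_lt_card (hfaulty.trans_lt hQ)

theorem exists_nonfaulty_mem_inter {C : Config n D Req} (hn : 3 * C.f < n)
    (hfaulty : C.faulty.card ≤ C.f) {Q Q' : Finset (Fin n)} (hQ : n - C.f ≤ Q.card)
    (hQ' : n - C.f ≤ Q'.card) : ∃ q, q ∉ C.faulty ∧ q ∈ Q ∧ q ∈ Q' := by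
  have h1 := Finset.card_union_add_card_inter Q Q'
  have h2 : (Q ∪ Q').card ≤ n := (Finset.card_le_univ _).trans_eq (Fintype.card_fin n)
  obtain ⟨q, hq, hf⟩ := exists_nonfaulty_mem hfaulty (Q := Q ∩ Q') (by omega)
  exact ⟨q, hf, Finset.mem_inter.1 hq⟩

/-! ### Invariants of the non-faulty votes -/

/-- What holds, in every reachable state, for the votes of non-faulty replicas. -/
structure VoteInvariant (C : Config n D Req) (s : State n D Req) : Prop where
  view_le : ∀ r ∉ C.faulty, ∀ c, s.Voted r c → c.view ≤ (s.view r : WithBot ℕ)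
  unique : ∀ r ∉ C.faulty, ∀ c c', s.Voted r c → s.Voted r c' → c.view = c'.view → c = c'
  parent_prepared : ∀ r ∉ C.faulty, ∀ m, s.Voted r (C.claimOf (.propose m)) →
    ∃ P ∈ s.prepared r, m.parent = C.claimOf P
  /-- After a vote for a child of `P₁`, a replica is locked at least as high as the parent `G` of `P₁`, and
  its votes in higher views respect such a lock `L`. -/
  respects_lock : ∀ r ∉ C.faulty, ∀ m₁ m₂, s.Voted r (C.claimOf (.propose m₁)) →
    s.Voted r (C.claimOf (.propose m₂)) → m₁.view < m₂.view →
    ∀ P₁ G, m₁.parent = C.claimOf P₁ → C.IsParent G P₁ → G.view < P₁.view →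
    ∃ P₂ L, m₂.parent = C.claimOf P₂ ∧ G.view ≤ L.view ∧
      ((L = P₂ ∨ C.Precedes L P₂) ∨ L.view < P₂.view)
  /-- The quorum `Q` consists of replicas that voted for the parent `P` before any non-faulty replica voted
  for the child `m`. -/
  parent_first : ∀ m P, m.parent = C.claimOf P →
    (∃ r, r ∉ C.faulty ∧ s.Voted r (C.claimOf (.propose m))) →
    P = .genesis ∨ ∃ Q : Finset (Fin n), n - C.f ≤ Q.card ∧ ∀ q ∈ Q, s.Voted q (C.claimOf P) ∧
      (q ∉ C.faulty → s.Voted q (C.claimOf (.propose m)) → P.view < (m.view : WithBot ℕ))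

/-- Steps that add no vote of a non-faulty replica preserve the invariants of the votes. -/
theorem VoteInvariant.of_voted_imp {C : Config n D Req} {s t : State n D Req}
    (h : VoteInvariant C s) (hsent : s.sent ⊆ t.sent)
    (hvote : ∀ r ∉ C.faulty, ∀ c, t.Voted r c → s.Voted r c)
    (hview : ∀ r, s.view r ≤ t.view r) (hprep : ∀ r, s.prepared r ⊆ t.prepared r) :
    VoteInvariant C t where
  view_le r hr c hc :=
    (h.view_le r hr c (hvote r hr c hc)).trans (WithBot.coe_le_coe.2 (hview r))
  unique r hr c c' hc hc' := h.unique r hr c c' (hvote r hr c hc) (hvote r hr c' hc')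
  parent_prepared r hr m hm := by
    obtain ⟨P, hP, h'⟩ := h.parent_prepared r hr m (hvote r hr _ hm)
    exact ⟨P, hprep r hP, h'⟩
  respects_lock r hr m₁ m₂ h₁ h₂ :=
    h.respects_lock r hr m₁ m₂ (hvote r hr _ h₁) (hvote r hr _ h₂)
  parent_first m P hmP := by
    rintro ⟨r, hr, hm⟩
    obtain h0 | ⟨Q, hQ, hv⟩ := h.parent_first m P hmP ⟨r, hr, hvote r hr _ hm⟩
    · exact Or.inl h0
    · exact Or.inr ⟨Q, hQ, fun q hq => ⟨(hv q hq).1.mono hsent,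
        fun hqf hqm => (hv q hq).2 hqf (hvote q hqf _ hqm)⟩⟩

/-- An `accept` step preserves the invariants of the votes. -/
theorem VoteInvariant.accept {C : Config n D Req} (hC : Function.Injective C.digest)
    {s : State n D Req} (h : VoteInvariant C s) {r : Fin n} {m : ProposeMsg n D Req}
    {cp : Finset (Claim D)} (hcert : ∀ P ∈ s.prepared r, s.IsCertified C P)
    (hr : r ∉ C.faulty) (hv : m.view = s.view r) (hacc : s.Acceptable C r m)
    (honce : ∀ σ : SyncMsg n D, Msg.sync σ ∈ s.sent → σ.sender = r → σ.view = m.view →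
      σ.claim = none) :
    VoteInvariant C (s.send (.sync ⟨r, m.view, some (C.claimOf (.propose m)), cp⟩)) := by
  have hinj := Config.claimOf_injective hC
  obtain ⟨P₀, hP₀, hmP₀, L, hL, hrule⟩ := hacc
  set t := s.send (.sync ⟨r, m.view, some (C.claimOf (.propose m)), cp⟩) with ht
  have hsub : s.sent ⊆ t.sent := Set.subset_insert _ _
  -- The only new vote is the one of `r` for `m`.
  have hvote : ∀ q c, t.Voted q c → s.Voted q c ∨ (q = r ∧ c = C.claimOf (.propose m)) := by
    intro q c hc
    rcases State.voted_send.1 hc with hc | ⟨σ, hσ, hq, hsup⟩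
    · exact Or.inl hc
    · cases hσ
      exact Or.inr ⟨hq.symm, (Option.some.inj hsup.2).symm⟩
  -- It has a higher view than all earlier votes of `r`.
  have hlt : ∀ c, s.Voted r c → c.view < (m.view : WithBot ℕ) := by
    intro c hc
    refine lt_of_le_of_ne (hv ▸ h.view_le r hr c hc) fun he => ?_
    obtain ⟨σ, hσ, hq, hsup⟩ := hc
    have := honce σ hσ hq (WithBot.coe_inj.1 (hsup.1.trans he))
    simp [hsup.2] at this
  refine ⟨?_, ?_, ?_, ?_, ?_⟩
  · intro q hq c hc
    rcases hvote q c hc with hc | ⟨rfl, rfl⟩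
    · exact h.view_le q hq c hc
    · exact WithBot.coe_le_coe.2 hv.le
  · intro q hq c c' hc hc' he
    rcases hvote q c hc with hs | ⟨rfl, rfl⟩ <;> rcases hvote _ c' hc' with hs' | ⟨hqr, rfl⟩
    · exact h.unique q hq c c' hs hs' he
    · subst hqr; exact absurd he (hlt c hs).ne
    · exact absurd he.symm (hlt c' hs').ne
    · rfl
  · intro q hq m' hm'
    rcases hvote q _ hm' with hm' | ⟨rfl, he⟩
    · exact h.parent_prepared q hq m' hm'
    · cases hinj he
      exact ⟨P₀, hP₀, hmP₀⟩
  · intro q hq m₁ m₂ h₁ h₂ h12 P₁ G hP₁ hG hGlt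
    rcases hvote q _ h₂ with hs₂ | ⟨rfl, he⟩
    · rcases hvote q _ h₁ with hs₁ | ⟨rfl, he⟩
      · exact h.respects_lock q hq m₁ m₂ hs₁ hs₂ h12 P₁ G hP₁ hG hGlt
      · cases hinj he
        exact absurd (WithBot.coe_lt_coe.1 (hlt _ hs₂)) h12.not_gt
    · cases hinj he
      rcases hvote q _ h₁ with hs₁ | ⟨_, he⟩
      · -- The earlier vote of `q` shows that `q` conditionally commits `G`, so that `L` is as high as `G`.
        obtain ⟨P, hP, hP'⟩ := h.parent_prepared q hq m₁ hs₁
        cases hinj (hP₁.symm.trans hP')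
        exact ⟨P₀, L, hmP₀, hL.2 G (Or.inr ⟨P₁, hP, hG, hGlt⟩), hrule⟩
      · cases hinj he
        exact absurd h12 (lt_irrefl _)
  · rintro m' P hmP ⟨q, hq, hm'⟩
    by_cases hold : ∃ r', r' ∉ C.faulty ∧ s.Voted r' (C.claimOf (.propose m'))
    · obtain h0 | ⟨Q, hQ, hQv⟩ := h.parent_first m' P hmP hold
      · exact Or.inl h0
      refine Or.inr ⟨Q, hQ, fun q' hq' => ⟨(hQv q' hq').1.mono hsub, fun hf hvt => ?_⟩⟩
      rcases hvote q' _ hvt with hvt | ⟨rfl, he⟩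
      · exact (hQv q' hq').2 hf hvt
      · cases hinj he
        exact hlt _ (hQv q' hq').1
    · rcases hvote q _ hm' with hm' | ⟨rfl, he⟩
      · exact absurd ⟨q, hq, hm'⟩ hold
      cases hinj he
      cases hinj (hmP.symm.trans hmP₀)
      -- The first non-faulty vote for `m`: any quorum for the parent will do.
      obtain h0 | ⟨Q, hQ, hQv⟩ := hcert _ hP₀
      · exact Or.inl h0
      refine Or.inr ⟨Q, hQ, fun q' hq' => ⟨(hQv q' hq').mono hsub, fun hf hvt => ?_⟩⟩
      rcases hvote q' _ hvt with hvt | ⟨rfl, -⟩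
      · exact absurd ⟨q', hf, hvt⟩ hold
      · exact hlt _ (hQv q' hq')

/-! ### Invariants of reachable states -/

/-- What holds in every reachable state. -/
structure Invariant (C : Config n D Req) (s : State n D Req) : Prop extends VoteInvariant C s where
  received_subset : ∀ r, s.received r ⊆ s.sent
  cp_prepared : ∀ σ : SyncMsg n D, Msg.sync σ ∈ s.sent → σ.sender ∉ C.faulty → ∀ c ∈ σ.cp,
    ∃ P ∈ s.prepared σ.sender, c = C.claimOf P
  prepared_certified : ∀ r ∉ C.faulty, ∀ P ∈ s.prepared r, s.IsCertified C P

theorem Invariant.start (C : Config n D Req) : Invariant C (State.start : State n D Req) := by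
  have hvote : ∀ q c, ¬ (State.start : State n D Req).Voted q c := fun q c ⟨_, h, _⟩ => h
  exact
    { view_le := fun r _ c hc => absurd hc (hvote r c)
      unique := fun r _ c _ hc => absurd hc (hvote r c)
      parent_prepared := fun r _ m hm => absurd hm (hvote r _)
      respects_lock := fun r _ m _ hm => absurd hm (hvote r _)
      parent_first := fun m P _ ⟨r, _, hm⟩ => absurd hm (hvote r _)
      received_subset := fun r => Set.Subset.rfl
      cp_prepared := fun σ hσ => hσ.elim
      prepared_certified := fun r _ P hP => Or.inl hP }

/-- Sending a message preserves the invariants if it preserves those of the votes and, should it be a `Sync`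
message of a non-faulty replica, its `CP` lists proposals which that replica prepared. -/
theorem Invariant.send {C : Config n D Req} {s : State n D Req} (h : Invariant C s)
    {msg : Msg n D Req} (hvotes : VoteInvariant C (s.send msg))
    (hcp : ∀ σ, msg = .sync σ → σ.sender ∉ C.faulty → ∀ c ∈ σ.cp,
      ∃ P ∈ s.prepared σ.sender, c = C.claimOf P) :
    Invariant C (s.send msg) where
  toVoteInvariant := hvotes
  received_subset r := (h.received_subset r).trans (Set.subset_insert _ _)
  cp_prepared σ hσ := by
    rcases hσ with hσ | hσ
    · exact hcp σ hσ.symm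
    · exact h.cp_prepared σ hσ
  prepared_certified r hr P hP := (h.prepared_certified r hr P hP).mono (Set.subset_insert _ _)

theorem VoteInvariant.send {C : Config n D Req} {s : State n D Req} (h : VoteInvariant C s)
    {msg : Msg n D Req}
    (hmsg : ∀ σ c, msg = .sync σ → σ.sender ∉ C.faulty → ¬ σ.Supports c) :
    VoteInvariant C (s.send msg) := by
  refine h.of_voted_imp (Set.subset_insert _ _) ?_ (fun _ => le_rfl) (fun _ => Set.Subset.rfl)
  intro r hr c hc
  rcases State.voted_send.1 hc with hc | ⟨σ, hσ, rfl, hsup⟩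
  · exact hc
  · exact absurd hsup (hmsg σ c hσ hr)

theorem Invariant.prepare {C : Config n D Req} {s : State n D Req} (h : Invariant C s) {r : Fin n}
    {P : Proposal n D Req} (hP : s.IsCertified C P) : Invariant C (s.prepare r P) := by
  have hmem : ∀ q P', P' ∈ (s.prepare r P).prepared q ↔ P' ∈ s.prepared q ∨ (q = r ∧ P' = P) := by
    intro q P'
    by_cases hq : q = r
    · subst hq; simp [State.prepare, or_comm]
    · simp [State.prepare, hq]
  have hsub : ∀ q, s.prepared q ⊆ (s.prepare r P).prepared q :=
    fun q P' hP' => (hmem q P').2 (Or.inl hP')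
  exact
    { toVoteInvariant := h.toVoteInvariant.of_voted_imp Set.Subset.rfl (fun _ _ _ hc => hc)
        (fun _ => le_rfl) hsub
      received_subset := h.received_subset
      cp_prepared := fun σ hσ hf c hc => by
        obtain ⟨P', hP', he⟩ := h.cp_prepared σ hσ hf c hc
        exact ⟨P', hsub _ hP', he⟩
      prepared_certified := fun q hq P' hP' => by
        rcases (hmem q P').1 hP' with hP' | ⟨-, rfl⟩
        · exact h.prepared_certified q hq P' hP'
        · exact hP }

theorem Invariant.step {C : Config n D Req} (hfaulty : C.faulty.card ≤ C.f)
    (hC : Function.Injective C.digest) {s t : State n D Req} (h : Invariant C s)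
    (hst : Step C s t) : Invariant C t := by
  cases hst with
  | deliver r msg hsent =>
    refine ⟨h.toVoteInvariant.of_voted_imp Set.Subset.rfl (fun _ _ _ hc => hc) (fun _ => le_rfl)
      (fun _ => Set.Subset.rfl), ?_, h.cp_prepared, h.prepared_certified⟩
    intro q
    by_cases hq : q = r
    · subst hq
      simpa [State.deliver] using Set.insert_subset hsent (h.received_subset q)
    · simpa [State.deliver, hq] using h.received_subset q
  | byzantine b msg hb hsig =>
    have hf : ∀ σ, msg = .sync σ → σ.sender ∈ C.faulty := by
      rintro σ rfl
      exact (show σ.sender = b from hsig) ▸ hb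
    exact h.send (h.toVoteInvariant.send fun σ c hσ hn => absurd (hf σ hσ) hn)
      fun σ hσ hn => absurd (hf σ hσ) hn
  | enter r w hr hw =>
    refine ⟨h.toVoteInvariant.of_voted_imp Set.Subset.rfl (fun _ _ _ hc => hc) ?_
      (fun _ => Set.Subset.rfl), h.received_subset, h.cp_prepared, h.prepared_certified⟩
    intro q
    by_cases hq : q = r
    · subst hq; simpa [State.enter] using hw.le
    · simp [State.enter, hq]
  | propose r m hr hv hp hreq hnew hext =>
    exact h.send (h.toVoteInvariant.send (by simp)) (by simp)
  | record r m hr hrec hv hreq hagree hfirst =>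
    exact ⟨h.toVoteInvariant.of_voted_imp Set.Subset.rfl (fun _ _ _ hc => hc) (fun _ => le_rfl)
      (fun _ => Set.Subset.rfl), h.received_subset, h.cp_prepared, h.prepared_certified⟩
  | accept r m cp hr hv hknown hacc honce hcp =>
    refine h.send (h.toVoteInvariant.accept hC (h.prepared_certified r hr) hr hv hacc honce) ?_
    rintro σ hσ - c hc
    cases hσ
    obtain ⟨L, -, hL⟩ := hcp
    obtain ⟨P, hP, -, he⟩ := (hL c).1 hc
    exact ⟨P, hP, he⟩
  | failure r u cp hr hcp =>
    refine h.send (h.toVoteInvariant.send ?_) ?_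
    · rintro σ c hσ - hsup
      cases hσ
      cases hsup.2
    · rintro σ hσ - c hc
      cases hσ
      obtain ⟨L, -, hL⟩ := hcp
      obtain ⟨P, hP, -, he⟩ := (hL c).1 hc
      exact ⟨P, hP, he⟩
  | prepareSync r P hr hq =>
    obtain ⟨Q, hQ, hQv⟩ := hq
    refine h.prepare (Or.inr ⟨Q, hQ, fun q hq => ?_⟩)
    obtain ⟨σ, hσ, h1, h2⟩ := hQv q hq
    exact ⟨σ, h.received_subset r hσ, h1, h2⟩
  | prepareCert r m P hr hrec hcert hP =>
    obtain ⟨S, -, hS, Q, hQ, hQv⟩ := hcert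
    refine h.prepare (Or.inr ⟨Q, hQ, fun q hq => ?_⟩)
    obtain ⟨σ, hσ, h1, h2⟩ := hQv q hq
    exact ⟨σ, hS σ hσ, h1, hP ▸ h2⟩
  | prepareClaims r P hr hq =>
    -- One of the `f + 1` replicas is non-faulty, and it had prepared `P`.
    obtain ⟨Q, hQ, hQv⟩ := hq
    obtain ⟨q, hq, hqf⟩ := exists_nonfaulty_mem hfaulty (Q := Q) (by omega)
    obtain ⟨σ, hσ, rfl, -, hc⟩ := hQv q hq
    obtain ⟨P', hP', he⟩ := h.cp_prepared σ (h.received_subset r hσ) hqf _ hc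
    cases Config.claimOf_injective hC he
    exact h.prepare (h.prepared_certified _ hqf P hP')

theorem Reachable.invariant {C : Config n D Req} (hfaulty : C.faulty.card ≤ C.f)
    (hC : Function.Injective C.digest) {s : State n D Req} (hs : Reachable C s) :
    Invariant C s := by
  induction hs with
  | refl => exact Invariant.start C
  | tail _ hst ih => exact ih.step hfaulty hC hst

/-! ### Chains of certified proposals -/

section Chains

variable {C : Config n D Req} {s : State n D Req}

theorem Invariant.certified_unique (h : Invariant C s) (hn : 3 * C.f < n)
    (hfaulty : C.faulty.card ≤ C.f) (hC : Function.Injective C.digest) {P Q : Proposal n D Req}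
    (hP : s.IsCertified C P) (hQ : s.IsCertified C Q) (hview : P.view = Q.view) : P = Q := by
  rcases P with _ | p <;> rcases Q with _ | q
  · rfl
  · exact absurd hview.symm (WithBot.coe_ne_bot (a := q.view))
  · exact absurd hview (WithBot.coe_ne_bot (a := p.view))
  · obtain hP | ⟨A, hA, hAv⟩ := hP
    · cases hP
    obtain hQ | ⟨B, hB, hBv⟩ := hQ
    · cases hQ
    obtain ⟨r, hr, hrA, hrB⟩ := exists_nonfaulty_mem_inter hn hfaulty hA hB
    exact Config.claimOf_injective hC (h.unique r hr _ _ (hAv r hrA) (hBv r hrB) hview)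

/-- Certified proposals have certified parents, of lower views. -/
theorem Invariant.certified_parent (h : Invariant C s) (hn : 3 * C.f < n)
    (hfaulty : C.faulty.card ≤ C.f) (hC : Function.Injective C.digest) {P Q : Proposal n D Req}
    (hPQ : C.IsParent P Q) (hQ : s.IsCertified C Q) :
    s.IsCertified C P ∧ P.view < Q.view := by
  rcases Q with _ | m
  · exact hPQ.elim
  obtain hQ | ⟨A, hA, hAv⟩ := hQ
  · cases hQ
  have hmP : m.parent = C.claimOf P := hPQ
  obtain ⟨r, hr, hrA, -⟩ := exists_nonfaulty_mem_inter hn hfaulty hA hA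
  obtain ⟨P', hP', hmP'⟩ := h.parent_prepared r hr m (hAv r hrA)
  cases Config.claimOf_injective hC (hmP.symm.trans hmP')
  refine ⟨h.prepared_certified r hr P hP', ?_⟩
  obtain rfl | ⟨B, hB, hBv⟩ := h.parent_first m P hmP ⟨r, hr, hAv r hrA⟩
  · exact WithBot.bot_lt_coe m.view
  · obtain ⟨q, hq, hqA, hqB⟩ := exists_nonfaulty_mem_inter hn hfaulty hA hB
    exact (hBv q hqB).2 hq (hAv q hqA)

theorem Invariant.view_lt_of_precedes (h : Invariant C s) (hn : 3 * C.f < n)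
    (hfaulty : C.faulty.card ≤ C.f) (hC : Function.Injective C.digest) {P Q : Proposal n D Req}
    (hPQ : C.Precedes P Q) (hQ : s.IsCertified C Q) : P.view < Q.view := by
  induction hPQ with
  | single hp => exact (h.certified_parent hn hfaulty hC hp hQ).2
  | tail _ hp ih =>
    obtain ⟨h1, h2⟩ := h.certified_parent hn hfaulty hC hp hQ
    exact (ih h1).trans h2

/-- Above three certified proposals in consecutive views, each extending the one before, all certified proposals
extend the lowest of the three. -/
theorem Invariant.certified_eq_or_precedes (h : Invariant C s) (hn : 3 * C.f < n)
    (hfaulty : C.faulty.card ≤ C.f) (hC : Function.Injective C.digest) {v : ℕ}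
    {P P' P'' : Proposal n D Req} (hP : P.view = (v : WithBot ℕ))
    (hP' : P'.view = ((v + 1 : ℕ) : WithBot ℕ)) (hP'' : P''.view = ((v + 2 : ℕ) : WithBot ℕ))
    (hPP' : C.IsParent P P') (hPP'' : C.IsParent P' P'') (hcert : s.IsCertified C P'')
    (w : ℕ) (hvw : v ≤ w) (Q : Proposal n D Req) (hQ : s.IsCertified C Q)
    (hQw : Q.view = (w : WithBot ℕ)) : P = Q ∨ C.Precedes P Q := by
  induction w using Nat.strong_induction_on generalizing Q with
  | _ w ih =>
  have hcert' := (h.certified_parent hn hfaulty hC hPP'' hcert).1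
  have hcert0 := (h.certified_parent hn hfaulty hC hPP' hcert').1
  obtain rfl | rfl | rfl | hw : w = v ∨ w = v + 1 ∨ w = v + 2 ∨ v + 2 < w := by omega
  · exact Or.inl (h.certified_unique hn hfaulty hC hcert0 hQ (hP.trans hQw.symm))
  · cases h.certified_unique hn hfaulty hC hcert' hQ (hP'.trans hQw.symm)
    exact Or.inr (.single hPP')
  · cases h.certified_unique hn hfaulty hC hcert hQ (hP''.trans hQw.symm)
    exact Or.inr (.tail (.single hPP') hPP'')
  · rcases P'' with _ | m₁
    · exact hPP''.elim
    rcases Q with _ | m₂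
    · exact absurd hQw.symm (WithBot.coe_ne_bot (a := w))
    have hv₁ : m₁.view = v + 2 := WithBot.coe_inj.1 hP''
    have hv₂ : m₂.view = w := WithBot.coe_inj.1 hQw
    obtain hcert | ⟨A, hA, hAv⟩ := id hcert
    · cases hcert
    obtain hQ | ⟨B, hB, hBv⟩ := id hQ
    · cases hQ
    obtain ⟨r, hr, hrA, hrB⟩ := exists_nonfaulty_mem_inter hn hfaulty hA hB
    obtain ⟨X, L, hX, hL, hrule⟩ := h.respects_lock r hr m₁ m₂ (hAv r hrA) (hBv r hrB)
      (by omega) P' P hPP'' hPP' (by rw [hP, hP']; exact WithBot.coe_lt_coe.2 v.lt_succ_self)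
    obtain ⟨hXc, hXlt⟩ := h.certified_parent hn hfaulty hC (P := X) (Q := .propose m₂) hX hQ
    have hPX : P.view ≤ X.view := by
      rcases hrule with (rfl | hLX) | hLX
      · exact hL
      · exact hL.trans (h.view_lt_of_precedes hn hfaulty hC hLX hXc).le
      · exact hL.trans hLX.le
    rcases X with _ | x
    · rw [hP] at hPX
      exact absurd (le_bot_iff.1 hPX) (WithBot.coe_ne_bot (a := v))
    have hvx : v ≤ x.view := by
      rw [hP] at hPX
      exact WithBot.coe_le_coe.1 hPX
    have hxw : x.view < w := by
      rw [hQw] at hXlt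
      exact WithBot.coe_lt_coe.1 hXlt
    rcases ih x.view hxw hvx (.propose x) hXc rfl with he | hp
    · exact Or.inr (.single (he ▸ hX))
    · exact Or.inr (.tail hp hX)

end Chains

end PVP

theorem mainTheorem1 {n : ℕ} {D Req : Type*} (C : PVP.Config n D Req)
    (hn : 3 * C.f < n) (hfaulty : C.faulty.card ≤ C.f)
    (hdigest : Function.Injective C.digest)
    (s : PVP.State n D Req) (hs : PVP.Reachable C s)
    (r₁ r₂ : Fin n) (hr₁ : r₁ ∉ C.faulty) (hr₂ : r₂ ∉ C.faulty)
    (P₁ P₂ : PVP.Proposal n D Req)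
    (h₁ : s.Commits C r₁ P₁) (h₂ : s.Commits C r₂ P₂) :
    ¬ C.Conflicting P₁ P₂ := by
  have h := hs.invariant hfaulty hdigest
  rintro ⟨hne, h12, h21⟩
  obtain ⟨v, P', P'', hv, hP', hPP', hv', hP'', hPP'', hv''⟩ := h₁
  obtain ⟨w, Q', Q'', hw, hQ', hQQ', hw', hQ'', hQQ'', hw''⟩ := h₂
  have hP := (h.certified_parent hn hfaulty hdigest hPP' (h.prepared_certified _ hr₁ _ hP')).1
  have hQ := (h.certified_parent hn hfaulty hdigest hQQ' (h.prepared_certified _ hr₂ _ hQ')).1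
  rcases le_total v w with hle | hle
  · rcases h.certified_eq_or_precedes hn hfaulty hdigest hv hv' hv'' hPP' hPP''
      (h.prepared_certified _ hr₁ _ hP'') w hle P₂ hQ hw with he | hp
    exacts [hne he, h12 hp]
  · rcases h.certified_eq_or_precedes hn hfaulty hdigest hw hw' hw'' hQQ' hQQ''
      (h.prepared_certified _ hr₂ _ hQ'') v hle P₁ hP hv with he | hp
    exacts [hne he.symm, h21 hp]
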